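/- Identify a partition with its Young diagram, and write $|\lambda|$ for the size of $\lambda$. A rim $s$-hook of $\lambda$ is a connected set of $s$ nodes of the rim of $\lambda$ (the nodes $(r,c)$ of $\lambda$ such that $(r+1,c+1)$ is not a node of $\lambda$) whose removal leaves a Young diagram. An $s$-core is a partition with no rim $s$-hooks; $\operatorname{cor}_s(\lambda)$ is the $s$-core obtained from $\lambda$ by removing rim $s$-hooks until none remain, and $\operatorname{wei}_s(\lambda)$ is the number of rim $s$-hooks removed (both are independent of the choices made). Let $s,t>1$ be coprime integers, $\sigma$ an $s$-core, $\tau$ a $t$-core, and $n\geq 0$ an integer. Let $\mathcal P_{\sigma,\tau}(n)$ be the set of partitions of $n$ with $s$-core $\sigma$ and $t$-core $\tau$. Then there exist partitions with $s$-core $\sigma$ and $t$-core $\tau$; write $\mathtt m_{\sigma,\tau}$ for the smallest size of such a partition. The following are equivalent: 1. $|\mathcal P_{\sigma,\tau}(n)|=1$; 2. $\operatorname{cor}_t(\sigma)=\operatorname{cor}_s(\tau)$ and $n=|\sigma|+|\tau|-|\operatorname{cor}_t(\sigma)|$; 3. $n=\mathtt m_{\sigma,\tau}=|\tau|+t\operatorname{wei}_t(\sigma)$;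 4. $n=\mathtt m_{\sigma,\tau}=|\sigma|+s\operatorname{wei}_s(\tau)$. -/

import Mathlib

/-! Partitions are represented by Mathlib's Young diagrams; the size of the partition `μ` is
`μ.card`. A node is a pair `(r, c) : ℕ × ℕ` (row, column), indexed from `0`. -/

namespace SimulCores

/-- The rim of `μ`: the nodes `(r, c)` of `μ` such that `(r + 1, c + 1)` is not a node of `μ`. -/
def rim (μ : YoungDiagram) : Finset (ℕ × ℕ) :=
  μ.cells.filter fun x => (x.1 + 1, x.2 + 1) ∉ μ.cells

/-- `H` is a rim `s`-hook of `μ`: a connected set of `s` nodes in the rim which can be removed to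
leave a Young diagram (a lower set). Two nodes are adjacent when they share an edge, that is, when
one covers the other in the product order on `ℕ × ℕ`. -/
structure IsRimHook (s : ℕ) (μ : YoungDiagram) (H : Finset (ℕ × ℕ)) : Prop where
  subset_rim : H ⊆ rim μ
  card_eq : H.card = s
  connected : ((SimpleGraph.hasse (ℕ × ℕ)).induce (H : Set (ℕ × ℕ))).Connected
  removable : IsLowerSet ((μ.cells \ H : Finset (ℕ × ℕ)) : Set (ℕ × ℕ))

/-- `ν` is obtained from `μ` by removing a rim `s`-hook. -/
def RemovesHook (s : ℕ) (μ ν : YoungDiagram) : Prop :=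
  ∃ H : Finset (ℕ × ℕ), IsRimHook s μ H ∧ ν.cells = μ.cells \ H

/-- `μ` is an `s`-core: it has no rim `s`-hooks. -/
def IsCore (s : ℕ) (μ : YoungDiagram) : Prop :=
  ∀ H : Finset (ℕ × ℕ), ¬ IsRimHook s μ H

/-- `Reduces s k μ ν`: the partition `ν` is obtained from `μ` by successively removing exactly `k`
rim `s`-hooks. -/
inductive Reduces (s : ℕ) : ℕ → YoungDiagram → YoungDiagram → Prop
  | refl (μ : YoungDiagram) : Reduces s 0 μ μ
  | step {k : ℕ} {μ ν ρ : YoungDiagram} :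
      RemovesHook s μ ν → Reduces s k ν ρ → Reduces s (k + 1) μ ρ

theorem RemovesHook.card_lt {s : ℕ} {μ ν : YoungDiagram} (h : RemovesHook s μ ν) :
    ν.card < μ.card := by
  obtain ⟨H, hH, hν⟩ := h
  obtain ⟨x⟩ := hH.connected.nonempty
  refine Finset.card_lt_card ?_
  rw [hν]
  refine Finset.sdiff_ssubset (fun y hy => ?_) ⟨x.1, x.2⟩
  exact (Finset.mem_filter.1 (hH.subset_rim hy)).1

/-- Removing rim `s`-hooks until none remain terminates. -/
theorem exists_reduces_core (s : ℕ) (μ : YoungDiagram) :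
    ∃ p : ℕ × YoungDiagram, Reduces s p.1 μ p.2 ∧ IsCore s p.2 := by
  induction hn : μ.card using Nat.strong_induction_on generalizing μ with
  | _ n ih =>
    by_cases hc : IsCore s μ
    · exact ⟨(0, μ), Reduces.refl μ, hc⟩
    · simp only [IsCore, not_forall, not_not] at hc
      obtain ⟨H, hH⟩ := hc
      have hr : RemovesHook s μ ⟨μ.cells \ H, hH.removable⟩ := ⟨H, hH, rfl⟩
      obtain ⟨p, hp, hpc⟩ := ih _ (hn ▸ hr.card_lt) _ rfl
      exact ⟨(p.1 + 1, p.2), Reduces.step hr hp, hpc⟩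

/-- The `s`-core of `μ`: the partition obtained by removing rim `s`-hooks until none remain
(independent of the hooks removed). -/
noncomputable def core (s : ℕ) (μ : YoungDiagram) : YoungDiagram :=
  (exists_reduces_core s μ).choose.2

/-- The `s`-weight of `μ`: the number of rim `s`-hooks removed from `μ` to reach its `s`-core. -/
noncomputable def weight (s : ℕ) (μ : YoungDiagram) : ℕ :=
  (exists_reduces_core s μ).choose.1

theorem reduces_core (s : ℕ) (μ : YoungDiagram) : Reduces s (weight s μ) μ (core s μ) :=
  (exists_reduces_core s μ).choose_spec.1

theorem isCore_core (s : ℕ) (μ : YoungDiagram) : IsCore s (core s μ) :=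
  (exists_reduces_core s μ).choose_spec.2

/-- The set of partitions of `n` with `s`-core `σ` and `t`-core `τ`. -/
def partitionsWithCores (s t : ℕ) (σ τ : YoungDiagram) (n : ℕ) : Set YoungDiagram :=
  {μ | μ.card = n ∧ core s μ = σ ∧ core t μ = τ}

/-- `μ` is `(s,t)`-minimal: no smaller partition has the same `s`-core and the same `t`-core. -/
def IsSTMinimal (s t : ℕ) (μ : YoungDiagram) : Prop :=
  ∀ ν : YoungDiagram, core s ν = core s μ → core t ν = core t μ → μ.card ≤ ν.card

/-- The set of `(s,t)`-minimal partitions with `s`-core `σ` and `t`-core `τ`. -/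
def minimalPartitions (s t : ℕ) (σ τ : YoungDiagram) : Set YoungDiagram :=
  {μ | core s μ = σ ∧ core t μ = τ ∧ IsSTMinimal s t μ}

/-- The common size of the `(s,t)`-minimal partitions with `s`-core `σ` and `t`-core `τ`. -/
noncomputable def minSize (s t : ℕ) (σ τ : YoungDiagram) : ℕ :=
  sInf (YoungDiagram.card '' minimalPartitions s t σ τ)

/-- Every `(s,t)`-minimal partition with the given cores has size `minSize`. -/
theorem card_eq_minSize {s t : ℕ} {σ τ μ : YoungDiagram} (h : μ ∈ minimalPartitions s t σ τ) :
    μ.card = minSize s t σ τ := by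
  obtain ⟨ν, hν, hc⟩ := Nat.sInf_mem (Set.Nonempty.image YoungDiagram.card ⟨μ, h⟩)
  refine le_antisymm ?_ (Nat.sInf_le ⟨μ, h, rfl⟩)
  rw [minSize, ← hc]
  exact h.2.2 ν (hν.1.trans h.1.symm) (hν.2.1.trans h.2.1.symm)

end SimulCores

/-! Encode a partition by its bead set, the numbers μ_i - i. Removing a rim s-hook moves a bead from
x to the free place x - s, so the s-core is determined by the s-charges, the signed bead counts in
the classes modulo s (`core_eq_iff`).

Exchanging x and x - t for all x in one class modulo s preserves t-charges and commutes with
translation by s; hence it keeps t-cores and s-weights and permutes s-cores. If an s-core σ is not a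
t-core, some such reflection shrinks it (`card_reflection_lt`). Iterating down to κ = cor_t(σ) gives
a bijection that keeps t-cores, turns the s-core σ into κ and lowers sizes by |σ| - |κ|
(`exists_equiv_core`). Treating τ likewise, with κ' = cor_s(τ), reduces everything to the pair κ,
κ', each of which is both an s-core and a t-core.

For this pair, if κ = κ' then κ is the unique partition of least size. Conversely, a partition with
these cores that fails to be an s-core or a t-core has a partner with the same size and cores
(`exists_ne_of_not_isCore`), so uniqueness forces it to be both κ and κ'. Conditions 3 and 4 say
that a minimal partition is carried to one of size |κ'| or |κ|, hence to κ' or κ itself. Partitions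
with prescribed cores exist by the Chinese remainder theorem (`exists_chg_eq_chg_eq`). -/

namespace SimulCores

/-! ### Young diagrams through the lengths of their diagonals -/

/-- The `k`-th node of the diagonal of content `d`. -/
def diagNode (d : ℤ) (k : ℕ) : ℕ × ℕ := (k + (-d).toNat, k + d.toNat)

theorem diagNode_content_min (p : ℕ × ℕ) :
    diagNode ((p.2 : ℤ) - p.1) (min p.1 p.2) = p := by
  obtain ⟨r, c⟩ := p
  simp only [diagNode, Prod.mk.injEq]
  omega

theorem diagNode_content (d : ℤ) (k : ℕ) :
    (((diagNode d k).2 : ℕ) : ℤ) - ((diagNode d k).1 : ℕ) = d := by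
  simp only [diagNode]
  omega

theorem diagNode_min (d : ℤ) (k : ℕ) : min (diagNode d k).1 (diagNode d k).2 = k := by
  simp only [diagNode]
  omega

theorem diagNode_inj {d e : ℤ} {k l : ℕ} : diagNode d k = diagNode e l ↔ d = e ∧ k = l := by
  refine ⟨fun h => ⟨?_, ?_⟩, fun h => by rw [h.1, h.2]⟩
  · rw [← diagNode_content d k, h, diagNode_content]
  · rw [← diagNode_min d k, h, diagNode_min]

theorem exists_diagNode_notMem (μ : YoungDiagram) (d : ℤ) : ∃ k, diagNode d k ∉ μ := by
  refine ⟨μ.colLen 0, fun h => ?_⟩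
  have h0 : (μ.colLen 0, 0) ∈ μ := μ.up_left_mem (Nat.le_add_right _ _) (Nat.zero_le _) h
  exact lt_irrefl _ (YoungDiagram.mem_iff_lt_colLen.1 h0)

/-- The number of nodes of `μ` on the diagonal of content `d`. -/
noncomputable def diagLen (μ : YoungDiagram) (d : ℤ) : ℕ := by
  classical exact Nat.find (exists_diagNode_notMem μ d)

theorem lt_diagLen {μ : YoungDiagram} {d : ℤ} {k : ℕ} : k < diagLen μ d ↔ diagNode d k ∈ μ := by
  classical
  refine ⟨fun h => not_not.1 (Nat.find_min (exists_diagNode_notMem μ d) h), fun h => ?_⟩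
  by_contra hk
  refine Nat.find_spec (exists_diagNode_notMem μ d) (μ.up_left_mem ?_ ?_ h)
  · exact Nat.add_le_add_right (not_lt.1 hk) _
  · exact Nat.add_le_add_right (not_lt.1 hk) _

theorem mem_iff_lt_diagLen {μ : YoungDiagram} {p : ℕ × ℕ} :
    p ∈ μ ↔ min p.1 p.2 < diagLen μ ((p.2 : ℤ) - p.1) := by
  rw [lt_diagLen, diagNode_content_min]

theorem eq_of_diagLen_eq {μ ν : YoungDiagram} (h : ∀ d, diagLen μ d = diagLen ν d) : μ = ν := by
  ext p
  rw [YoungDiagram.mem_cells, YoungDiagram.mem_cells, mem_iff_lt_diagLen, mem_iff_lt_diagLen, h]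

theorem exists_diagLen_eq_zero (μ : YoungDiagram) :
    ∃ M : ℕ, ∀ d : ℤ, (d < -M ∨ (M : ℤ) ≤ d) → diagLen μ d = 0 := by
  refine ⟨μ.rowLen 0 + μ.colLen 0, fun d hd => ?_⟩
  by_contra h0
  have h : diagNode d 0 ∈ μ := lt_diagLen.1 (Nat.pos_of_ne_zero h0)
  have hr := YoungDiagram.mem_iff_lt_rowLen.1 (μ.up_left_mem (Nat.zero_le _) le_rfl h)
  have hc := YoungDiagram.mem_iff_lt_colLen.1 (μ.up_left_mem le_rfl (Nat.zero_le _) h)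
  push_cast at hd
  omega

theorem diagLen_step_of_nonneg (μ : YoungDiagram) {x : ℤ} (hx : 0 ≤ x) :
    diagLen μ (x + 1) ≤ diagLen μ x ∧ diagLen μ x ≤ diagLen μ (x + 1) + 1 := by
  constructor
  · refine le_of_forall_lt fun k hk => ?_
    rw [lt_diagLen] at hk ⊢
    refine μ.up_left_mem ?_ ?_ hk <;> omega
  · by_contra hk
    refine lt_irrefl (diagLen μ (x + 1)) (lt_diagLen.2 ?_)
    refine μ.up_left_mem ?_ ?_ (lt_diagLen.1 (not_le.1 hk)) <;> omega

theorem diagLen_step_of_neg (μ : YoungDiagram) {x : ℤ} (hx : x < 0) :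
    diagLen μ x ≤ diagLen μ (x + 1) ∧ diagLen μ (x + 1) ≤ diagLen μ x + 1 := by
  constructor
  · refine le_of_forall_lt fun k hk => ?_
    rw [lt_diagLen] at hk ⊢
    refine μ.up_left_mem ?_ ?_ hk <;> omega
  · by_contra hk
    refine lt_irrefl (diagLen μ x) (lt_diagLen.2 ?_)
    refine μ.up_left_mem ?_ ?_ (lt_diagLen.1 (not_le.1 hk)) <;> omega

/-! ### Bead sets and their characterisation -/

open Classical in
/-- The indicator of `B` minus the indicator of the negative integers. -/
noncomputable def excess (B : Set ℤ) (x : ℤ) : ℤ :=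
  (if x ∈ B then 1 else 0) - if x < 0 then 1 else 0

/-- The set of beads of `μ`: the numbers `μ_i - i` for `i ≥ 1`, described by diagonals. -/
def beads (μ : YoungDiagram) : Set ℤ :=
  {x | (if x < 0 then 1 else 0) + (diagLen μ x : ℤ) - diagLen μ (x + 1) = 1}

theorem excess_beads (μ : YoungDiagram) (x : ℤ) :
    excess (beads μ) x = (diagLen μ x : ℤ) - diagLen μ (x + 1) := by
  classical
  unfold excess beads
  simp only [Set.mem_ofPred_eq]
  by_cases hx : x < 0
  · have := diagLen_step_of_neg μ hx
    simp only [hx, if_true]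
    split_ifs <;> omega
  · have := diagLen_step_of_nonneg μ (not_lt.1 hx)
    simp only [hx, if_false]
    split_ifs <;> omega

theorem excess_injective : Function.Injective excess := by
  classical
  intro A B h
  ext x
  have hx := congrFun h x
  unfold excess at hx
  by_cases ha : x ∈ A <;> by_cases hb : x ∈ B <;> simp only [ha, hb, if_true, if_false] at hx ⊢ <;> omega

/-- The excess is the difference sequence of the diagonal lengths, and both sides vanish far to the
right, so downward induction recovers the lengths. -/
theorem diagLen_sub_eq_of_excess {μ ν : YoungDiagram} {g : ℤ → ℤ}
    (hg : ∃ M : ℤ, ∀ d, M ≤ d → g d = 0)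
    (h : ∀ x, excess (beads μ) x = excess (beads ν) x + g x - g (x + 1)) (d : ℤ) :
    (diagLen μ d : ℤ) = diagLen ν d + g d := by
  obtain ⟨M, hM⟩ := hg
  obtain ⟨M₁, h₁⟩ := exists_diagLen_eq_zero μ
  obtain ⟨M₂, h₂⟩ := exists_diagLen_eq_zero ν
  have key : ∀ k : ℕ, ∀ d : ℤ, max M (max M₁ M₂) - k ≤ d →
      (diagLen μ d : ℤ) = diagLen ν d + g d := by
    intro k
    induction k with
    | zero =>
      intro d hd
      rw [h₁ d (by omega), h₂ d (by omega), hM d (by omega)]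
      rfl
    | succ k ih =>
      intro d hd
      have := ih (d + 1) (by push_cast at hd; omega)
      have hx := h d
      rw [excess_beads, excess_beads] at hx
      omega
  exact key (max M (max M₁ M₂) - d).toNat d (by omega)

theorem beads_injective : Function.Injective beads := by
  intro μ ν h
  refine eq_of_diagLen_eq fun d => ?_
  have := diagLen_sub_eq_of_excess (μ := μ) (ν := ν) (g := 0) ⟨0, fun _ _ => rfl⟩
    (fun x => by simp [h]) d
  simpa using this

/-- `B` is obtained from the negative integers by adding and removing the same finite number of
elements. -/
def IsMaya (B : Set ℤ) : Prop :=
  (Function.support (excess B)).Finite ∧ ∑ᶠ x, excess B x = 0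

theorem isMaya_beads (μ : YoungDiagram) : IsMaya (beads μ) := by
  obtain ⟨M, hM⟩ := exists_diagLen_eq_zero μ
  have hf : (Function.support fun x : ℤ => (diagLen μ x : ℤ)).Finite := by
    refine (Set.finite_Ico (-M : ℤ) M).subset fun x hx => ?_
    by_contra h
    refine hx ?_
    rw [Set.mem_Ico] at h
    simp only [hM x (by omega), Nat.cast_zero]
  have hf' : (Function.support fun x : ℤ => (diagLen μ (x + 1) : ℤ)).Finite := by
    refine (Set.finite_Ico (-M - 1 : ℤ) M).subset fun x hx => ?_
    by_contra h
    refine hx ?_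
    rw [Set.mem_Ico] at h
    simp only [hM (x + 1) (by omega), Nat.cast_zero]
  have he : excess (beads μ) = fun x => (diagLen μ x : ℤ) - diagLen μ (x + 1) :=
    funext (excess_beads μ)
  rw [IsMaya, he]
  refine ⟨(hf.union hf').subset (Function.support_sub _ _), ?_⟩
  rw [finsum_sub_distrib hf hf', sub_eq_zero]
  exact (finsum_comp_equiv (Equiv.addRight (1 : ℤ)) (f := fun x => (diagLen μ x : ℤ))).symm

/-- The Young diagram whose diagonals have the lengths prescribed by `L`. -/
theorem exists_diagLen_eq {L : ℤ → ℕ} {M : ℕ} (hM : ∀ d : ℤ, (d < -M ∨ (M : ℤ) ≤ d) → L d = 0)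
    (hp : ∀ x : ℤ, 0 ≤ x → L (x + 1) ≤ L x ∧ L x ≤ L (x + 1) + 1)
    (hn : ∀ x : ℤ, x < 0 → L x ≤ L (x + 1) ∧ L (x + 1) ≤ L x + 1) :
    ∃ μ : YoungDiagram, ∀ d, diagLen μ d = L d := by
  classical
  let cells : Finset (ℕ × ℕ) :=
    (Finset.Ico (-M : ℤ) M).biUnion fun d => (Finset.range (L d)).image (diagNode d)
  have hmem : ∀ p : ℕ × ℕ, p ∈ cells ↔ min p.1 p.2 < L ((p.2 : ℤ) - p.1) := by
    intro p
    simp only [cells, Finset.mem_biUnion, Finset.mem_Ico, Finset.mem_image, Finset.mem_range]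
    constructor
    · rintro ⟨d, -, k, hk, rfl⟩
      rwa [diagNode_content, diagNode_min]
    · intro h
      refine ⟨(p.2 : ℤ) - p.1, ?_, min p.1 p.2, h, diagNode_content_min p⟩
      by_contra hd
      rw [hM _ (by omega)] at h
      exact Nat.not_lt_zero _ h
  have hrow : ∀ r c : ℕ, (r + 1, c) ∈ cells → (r, c) ∈ cells := by
    intro r c h
    rw [hmem] at h ⊢
    simp only at h ⊢
    have e : ((c : ℤ) - (r + 1 : ℕ)) + 1 = c - r := by push_cast; ring
    rw [← e]
    by_cases hd : (c : ℤ) - (r + 1 : ℕ) < 0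
    · have := hn _ hd
      omega
    · have := hp _ (not_lt.1 hd)
      omega
  have hcol : ∀ r c : ℕ, (r, c + 1) ∈ cells → (r, c) ∈ cells := by
    intro r c h
    rw [hmem] at h ⊢
    simp only at h ⊢
    have e : ((c + 1 : ℕ) : ℤ) - r = ((c : ℤ) - r) + 1 := by push_cast; ring
    rw [e] at h
    by_cases hd : (c : ℤ) - r < 0
    · have := hn _ hd
      omega
    · have := hp _ (not_lt.1 hd)
      omega
  have hrow' : ∀ k r c : ℕ, (r + k, c) ∈ cells → (r, c) ∈ cells := by
    intro k
    induction k with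
    | zero => exact fun r c h => h
    | succ k ih => exact fun r c h => ih r c (hrow (r + k) c h)
  have hcol' : ∀ k r c : ℕ, (r, c + k) ∈ cells → (r, c) ∈ cells := by
    intro k
    induction k with
    | zero => exact fun r c h => h
    | succ k ih => exact fun r c h => ih r c (hcol r (c + k) h)
  have hlow : IsLowerSet (cells : Set (ℕ × ℕ)) := by
    rintro ⟨r, c⟩ ⟨r', c'⟩ ⟨h₁, h₂⟩ h
    obtain ⟨a, rfl⟩ := Nat.exists_eq_add_of_le h₁
    obtain ⟨b, rfl⟩ := Nat.exists_eq_add_of_le h₂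
    exact hrow' a _ _ (hcol' b _ _ h)
  refine ⟨⟨cells, hlow⟩, fun d => eq_of_forall_lt_iff fun k => ?_⟩
  rw [lt_diagLen, YoungDiagram.mem_mk, hmem, diagNode_content, diagNode_min]

/-- Summing the excess from x upwards gives the only possible length of the diagonal x. Such a sum
is non-negative: for x ≥ 0 all its terms are, and for x ≤ 0 it is minus the sum of the terms below
x, because the total is zero. -/
theorem IsMaya.exists_beads_eq {B : Set ℤ} (hB : IsMaya B) : ∃ μ, beads μ = B := by
  classical
  obtain ⟨hfin, hsum⟩ := hB
  obtain ⟨M, hM⟩ : ∃ M : ℕ, ∀ x : ℤ, (x < -M ∨ (M : ℤ) ≤ x) → excess B x = 0 := by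
    obtain ⟨b, hb⟩ := hfin.bddAbove
    obtain ⟨a, ha⟩ := hfin.bddBelow
    have h₀ := neg_abs_le a
    have h₃ := le_abs_self b
    have h₄ := abs_nonneg a
    have h₅ := abs_nonneg b
    refine ⟨a.natAbs + b.natAbs + 1, fun x hx => ?_⟩
    by_contra h
    have h₁ := hb (Function.mem_support.2 h)
    have h₂ := ha (Function.mem_support.2 h)
    push_cast at hx
    omega
  let L : ℤ → ℤ := fun x => ∑ y ∈ Finset.Ico x M, excess B y
  have htop : ∀ x : ℤ, (M : ℤ) ≤ x → L x = 0 := fun x hx => by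
    simp only [L, Finset.Ico_eq_empty (not_lt.2 hx), Finset.sum_empty]
  have hstep : ∀ x : ℤ, L x = excess B x + L (x + 1) := by
    intro x
    rcases lt_or_ge x (M : ℤ) with hx | hx
    · have : Finset.Ico x (M : ℤ) = insert x (Finset.Ico (x + 1) (M : ℤ)) := by
        ext y
        simp only [Finset.mem_insert, Finset.mem_Ico]
        omega
      simp only [L, this]
      rw [Finset.sum_insert (by simp)]
    · rw [htop x hx, htop (x + 1) (by omega), hM x (Or.inr hx), add_zero]
  have hbot : ∀ x : ℤ, x ≤ -M → L x = 0 := by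
    intro x hx
    rw [← hsum, finsum_eq_sum_of_support_subset]
    intro y hy
    rw [Finset.coe_Ico, Set.mem_Ico]
    by_contra h
    exact hy (hM y (by omega))
  have hpos : ∀ k : ℕ, ∀ x : ℤ, 0 ≤ x → (M : ℤ) - k ≤ x → 0 ≤ L x := by
    intro k
    induction k with
    | zero => exact fun x _ hx => (htop x (by simpa using hx)).ge
    | succ k ih =>
      intro x hx hk
      rw [hstep]
      have := ih (x + 1) (by omega) (by push_cast at hk; omega)
      have h1 : 0 ≤ excess B x := by
        unfold excess
        split_ifs <;> omega
      omega
  have hneg : ∀ k : ℕ, ∀ x : ℤ, x ≤ 0 → x ≤ -M + k → 0 ≤ L x := by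
    intro k
    induction k with
    | zero => exact fun x _ hx => (hbot x (by simpa using hx)).ge
    | succ k ih =>
      intro x hx hk
      have h2 := hstep (x - 1)
      rw [sub_add_cancel] at h2
      have := ih (x - 1) (by omega) (by push_cast at hk; omega)
      have h1 : excess B (x - 1) ≤ 0 := by
        unfold excess
        split_ifs <;> omega
      omega
  have hL : ∀ x, 0 ≤ L x := by
    intro x
    rcases le_total 0 x with hx | hx
    · exact hpos (M - x).toNat x hx (by omega)
    · exact hneg (x + M).toNat x hx (by omega)
  have hex : ∀ x, (x < 0 → -1 ≤ excess B x ∧ excess B x ≤ 0) ∧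
      (0 ≤ x → 0 ≤ excess B x ∧ excess B x ≤ 1) := by
    intro x
    unfold excess
    split_ifs <;> omega
  obtain ⟨μ, hμ⟩ : ∃ μ : YoungDiagram, ∀ d, diagLen μ d = (L d).toNat := by
    refine exists_diagLen_eq (M := M) ?_ ?_ ?_
    · rintro d (hd | hd)
      · simp only [hbot d hd.le, Int.toNat_zero]
      · simp only [htop d hd, Int.toNat_zero]
    · intro x hx
      have h1 := (hex x).2 hx
      have h2 := hL (x + 1)
      simp only [hstep x]
      omega
    · intro x hx
      have h1 := (hex x).1 hx
      have h2 := hL x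
      have h3 := hstep x
      have h4 := hL (x + 1)
      omega
  refine ⟨μ, excess_injective (funext fun x => ?_)⟩
  rw [excess_beads, hμ, hμ, Int.toNat_of_nonneg (hL _), Int.toNat_of_nonneg (hL _), hstep x]
  ring

/-! ### Moving one bead -/

/-- The set obtained from `B` by moving a bead from `x` to `y`. -/
def moveBead (B : Set ℤ) (x y : ℤ) : Set ℤ := insert y (B \ {x})

theorem mem_moveBead {B : Set ℤ} {x y z : ℤ} : z ∈ moveBead B x y ↔ z = y ∨ z ∈ B ∧ z ≠ x :=
  Iff.rfl

theorem excess_moveBead {B : Set ℤ} {x y : ℤ} (hx : x ∈ B) (hy : y ∉ B) (z : ℤ) :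
    excess (moveBead B x y) z =
      excess B z + (if z = y then 1 else 0) - if z = x then 1 else 0 := by
  have hxy : x ≠ y := fun h => hy (h ▸ hx)
  have hz : z ∈ moveBead B x y ↔ z = y ∨ z ∈ B ∧ z ≠ x := mem_moveBead
  unfold excess
  split_ifs <;> grind

theorem eq_moveBead_of_excess {A B : Set ℤ} {x y : ℤ} (hxy : x ≠ y)
    (h : ∀ z, excess A z = excess B z + (if z = y then 1 else 0) - if z = x then 1 else 0) :
    x ∈ B ∧ y ∉ B ∧ A = moveBead B x y := by
  have hx : x ∈ B := by
    have := h x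
    unfold excess at this
    by_contra hc
    simp only [hc, hxy, if_true, if_false] at this
    split_ifs at this <;> omega
  have hy : y ∉ B := by
    have := h y
    unfold excess at this
    intro hc
    simp only [hc, hxy.symm, if_true, if_false] at this
    split_ifs at this <;> omega
  exact ⟨hx, hy, excess_injective (funext fun z => by rw [h, excess_moveBead hx hy])⟩

theorem support_ite_eq_finite (x : ℤ) :
    (Function.support fun z : ℤ => if z = x then (1 : ℤ) else 0).Finite := by
  refine (Set.finite_singleton x).subset fun z hz => ?_
  by_contra h
  exact hz (if_neg h)

/-! ### Removing a rim hook is moving a bead -/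

theorem hasse_adj_iff {p q : ℕ × ℕ} : (SimpleGraph.hasse (ℕ × ℕ)).Adj p q ↔
    (p.1 = q.1 ∧ (p.2 + 1 = q.2 ∨ q.2 + 1 = p.2)) ∨
      (p.2 = q.2 ∧ (p.1 + 1 = q.1 ∨ q.1 + 1 = p.1)) := by
  rw [SimpleGraph.hasse_adj, Prod.covBy_iff, Prod.covBy_iff]
  simp only [Nat.covBy_iff_add_one_eq]
  omega

/-- A discrete intermediate value theorem: contents of adjacent nodes differ by one. -/
theorem exists_content_eq_of_connected {H : Finset (ℕ × ℕ)}
    (hH : ((SimpleGraph.hasse (ℕ × ℕ)).induce (H : Set (ℕ × ℕ))).Connected)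
    {p q : ℕ × ℕ} (hp : p ∈ H) (hq : q ∈ H) {d : ℤ} (hpd : (p.2 : ℤ) - p.1 ≤ d)
    (hqd : d ≤ (q.2 : ℤ) - q.1) : ∃ r ∈ H, (r.2 : ℤ) - r.1 = d := by
  by_contra! hd
  have key : ∀ u v : (H : Set (ℕ × ℕ)),
      ((SimpleGraph.hasse (ℕ × ℕ)).induce (H : Set (ℕ × ℕ))).Walk u v →
      (u.1.2 : ℤ) - u.1.1 ≤ d → (v.1.2 : ℤ) - v.1.1 ≤ d := by
    intro u v w
    induction w with
    | nil => exact id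
    | @cons u u' v' hadj _ ih =>
      intro hu
      refine ih ?_
      have h1 := hasse_adj_iff.1 (SimpleGraph.comap_adj.1 hadj)
      have h2 := hd u.1 u.2
      simp only [Function.Embedding.subtype_apply] at h1
      omega
  obtain ⟨w⟩ := hH.preconnected ⟨p, hp⟩ ⟨q, hq⟩
  exact hd q hq (le_antisymm (key _ _ w hpd) hqd)

theorem mem_rim {μ : YoungDiagram} {d : ℤ} {k : ℕ} :
    diagNode d k ∈ rim μ ↔ diagLen μ d = k + 1 := by
  have e : ((diagNode d k).1 + 1, (diagNode d k).2 + 1) = diagNode d (k + 1) := by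
    simp only [diagNode, Prod.mk.injEq]
    omega
  rw [rim, Finset.mem_filter, e, YoungDiagram.mem_cells, YoungDiagram.mem_cells, ← lt_diagLen,
    ← lt_diagLen]
  omega

/-- A diagonal has at most one rim node, so the s nodes have distinct contents; connectedness makes
these contents consecutive. -/
theorem IsRimHook.exists_content_interval {s : ℕ} {μ : YoungDiagram} {H : Finset (ℕ × ℕ)}
    (hH : IsRimHook s μ H) :
    ∃ a : ℤ, ∀ d : ℤ, (∃ p ∈ H, (p.2 : ℤ) - p.1 = d) ↔ a ≤ d ∧ d < a + s := by
  classical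
  have hinj : Set.InjOn (fun p : ℕ × ℕ => (p.2 : ℤ) - p.1) (H : Set (ℕ × ℕ)) := by
    intro p hp q hq hpq
    have h1 := hH.subset_rim hp
    have h2 := hH.subset_rim hq
    rw [← diagNode_content_min p, mem_rim] at h1
    rw [← diagNode_content_min q, mem_rim] at h2
    simp only at hpq
    rw [← diagNode_content_min p, ← diagNode_content_min q, diagNode_inj]
    rw [← hpq] at h2
    exact ⟨hpq, by omega⟩
  obtain ⟨x⟩ := hH.connected.nonempty
  set C := H.image fun p : ℕ × ℕ => (p.2 : ℤ) - p.1 with hC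
  have hne : C.Nonempty := ⟨_, Finset.mem_image_of_mem _ x.2⟩
  have hcard : C.card = s := by rw [hC, Finset.card_image_of_injOn hinj, hH.card_eq]
  have hmem : ∀ d : ℤ, (∃ p ∈ H, (p.2 : ℤ) - p.1 = d) ↔ d ∈ C := fun d => by
    rw [hC, Finset.mem_image]
  have hCI : C = Finset.Icc (C.min' hne) (C.max' hne) := by
    ext d
    rw [Finset.mem_Icc]
    refine ⟨fun h => ⟨C.min'_le d h, C.le_max' d h⟩, fun h => ?_⟩
    obtain ⟨p, hp, hp'⟩ := (hmem _).2 (C.min'_mem hne)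
    obtain ⟨q, hq, hq'⟩ := (hmem _).2 (C.max'_mem hne)
    exact (hmem d).1 (exists_content_eq_of_connected hH.connected hp hq (hp'.le.trans h.1)
      (h.2.trans hq'.ge))
  refine ⟨C.min' hne, fun d => ?_⟩
  rw [hmem]
  have hle := C.min'_le _ (C.max'_mem hne)
  generalize C.min' hne = a at hCI hle ⊢
  generalize C.max' hne = b at hCI hle
  rw [hCI, Int.card_Icc] at hcard
  rw [hCI, Finset.mem_Icc]
  omega

theorem IsRimHook.exists_diagLen_eq {s : ℕ} {μ ν : YoungDiagram} {H : Finset (ℕ × ℕ)}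
    (hH : IsRimHook s μ H) (hν : ν.cells = μ.cells \ H) :
    ∃ a : ℤ, ∀ d : ℤ,
      (diagLen μ d : ℤ) = diagLen ν d + if a ≤ d ∧ d < a + s then 1 else 0 := by
  obtain ⟨a, ha⟩ := hH.exists_content_interval
  have hmem : ∀ d k, k < diagLen ν d ↔ k < diagLen μ d ∧ diagNode d k ∉ H := by
    intro d k
    rw [lt_diagLen, lt_diagLen, ← YoungDiagram.mem_cells, hν, Finset.mem_sdiff,
      YoungDiagram.mem_cells]
  refine ⟨a, fun d => ?_⟩
  split_ifs with hd
  · obtain ⟨p, hp, rfl⟩ := (ha d).2 hd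
    have hp' := hp
    have h1 := hH.subset_rim hp
    rw [← diagNode_content_min p] at hp'
    rw [← diagNode_content_min p, mem_rim] at h1
    rw [h1]
    suffices h : diagLen ν ((p.2 : ℤ) - p.1) = min p.1 p.2 by rw [h]; push_cast; rfl
    refine eq_of_forall_lt_iff fun k => ?_
    rw [hmem, h1]
    constructor
    · rintro ⟨hk, hkH⟩
      refine lt_of_le_of_ne (Nat.lt_succ_iff.1 hk) ?_
      rintro rfl
      exact hkH hp'
    · intro hk
      refine ⟨by omega, fun hkH => ?_⟩
      have h2 := mem_rim.1 (hH.subset_rim hkH)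
      omega
  · rw [add_zero]
    congr 1
    refine eq_of_forall_lt_iff fun k => ?_
    rw [hmem, and_iff_left]
    exact fun hk => hd ((ha d).1 ⟨_, hk, diagNode_content d k⟩)

theorem RemovesHook.exists_moveBead {s : ℕ} (hs : 0 < s) {μ ν : YoungDiagram}
    (h : RemovesHook s μ ν) :
    ∃ x ∈ beads μ, x - s ∉ beads μ ∧ beads ν = moveBead (beads μ) x (x - s) := by
  obtain ⟨H, hH, hν⟩ := h
  obtain ⟨a, ha⟩ := hH.exists_diagLen_eq hν
  -- The diagonals a, ..., a + s - 1 lose a node each, so the differences of consecutive lengths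
  -- change only at a + s - 1 and a - 1.
  refine ⟨a + s - 1, eq_moveBead_of_excess (by omega) fun z => ?_⟩
  rw [excess_beads, excess_beads, ha z, ha (z + 1)]
  split_ifs <;> omega

/-- The diagonals x - s + 1, ..., x each lose their last node. These nodes form a hook: lengths of
neighbouring diagonals differ by at most one, in the direction that makes their last nodes adjacent.
-/
theorem removesHook_of_moveBead {s : ℕ} (hs : 0 < s) {μ ν : YoungDiagram} {x : ℤ}
    (hx : x ∈ beads μ) (hy : x - s ∉ beads μ) (h : beads ν = moveBead (beads μ) x (x - s)) :
    RemovesHook s μ ν := by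
  have hlen : ∀ d : ℤ, (diagLen μ d : ℤ) =
      diagLen ν d + if x - s + 1 ≤ d ∧ d ≤ x then 1 else 0 := by
    refine diagLen_sub_eq_of_excess ⟨x + 1, fun d hd => if_neg (by omega)⟩ fun z => ?_
    rw [h, excess_moveBead hx hy]
    split_ifs <;> omega
  have hle : ∀ d, diagLen ν d ≤ diagLen μ d := fun d => by
    have := hlen d
    split_ifs at this <;> omega
  have hsub : ν.cells ⊆ μ.cells := fun p hp => by
    rw [YoungDiagram.mem_cells, mem_iff_lt_diagLen] at hp ⊢
    exact hp.trans_le (hle _)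
  have hmem : ∀ d k, diagNode d k ∈ μ.cells \ ν.cells ↔
      (x - s + 1 ≤ d ∧ d ≤ x) ∧ diagLen μ d = k + 1 := by
    intro d k
    have := hlen d
    rw [Finset.mem_sdiff, YoungDiagram.mem_cells, YoungDiagram.mem_cells, ← lt_diagLen,
      ← lt_diagLen]
    split_ifs at this <;> omega
  have hpos : ∀ d, x - s + 1 ≤ d ∧ d ≤ x → diagLen μ d = diagLen μ d - 1 + 1 := fun d hd => by
    have := hlen d
    rw [if_pos hd] at this
    omega
  have hnode : ∀ d, x - s + 1 ≤ d ∧ d ≤ x →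
      diagNode d (diagLen μ d - 1) ∈ μ.cells \ ν.cells :=
    fun d hd => (hmem _ _).2 ⟨hd, hpos d hd⟩
  have hform : ∀ p ∈ μ.cells \ ν.cells, ∃ d, (x - s + 1 ≤ d ∧ d ≤ x) ∧
      p = diagNode d (diagLen μ d - 1) := by
    intro p hp
    rw [← diagNode_content_min p, hmem] at hp
    refine ⟨_, hp.1, ?_⟩
    rw [hp.2, Nat.add_sub_cancel, diagNode_content_min]
  refine ⟨μ.cells \ ν.cells, ⟨?_, ?_, ?_, ?_⟩, ?_⟩
  · intro p hp
    rw [← diagNode_content_min p, hmem] at hp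
    rw [← diagNode_content_min p, mem_rim]
    exact hp.2
  · have e : μ.cells \ ν.cells =
        (Finset.Icc (x - s + 1) x).image fun d => diagNode d (diagLen μ d - 1) := by
      ext p
      rw [Finset.mem_image]
      constructor
      · intro hp
        obtain ⟨d, hd, rfl⟩ := hform p hp
        exact ⟨d, Finset.mem_Icc.2 hd, rfl⟩
      · rintro ⟨d, hd, rfl⟩
        exact hnode d (Finset.mem_Icc.1 hd)
    rw [e, Finset.card_image_of_injective _ fun d d' hd => (diagNode_inj.1 hd).1, Int.card_Icc]
    omega
  · have hreach : ∀ k : ℕ, ∀ hk : x - s + 1 ≤ x - k ∧ x - k ≤ x,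
        ((SimpleGraph.hasse (ℕ × ℕ)).induce
          ((μ.cells \ ν.cells : Finset (ℕ × ℕ)) : Set (ℕ × ℕ))).Reachable
          ⟨_, hnode x ⟨by omega, le_rfl⟩⟩ ⟨_, hnode (x - k) hk⟩ := by
      intro k
      induction k with
      | zero =>
        intro hk
        have e : x - (0 : ℕ) = x := by simp
        simp only [e]
        rfl
      | succ k ih =>
        intro hk
        have hk' : x - s + 1 ≤ x - k ∧ x - (k : ℤ) ≤ x := by push_cast at hk; omega
        refine (ih hk').trans (SimpleGraph.Adj.reachable ?_)
        rw [SimpleGraph.comap_adj, hasse_adj_iff]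
        have e : x - (k : ℤ) = x - ((k + 1 : ℕ) : ℤ) + 1 := by push_cast; ring
        have h1 := hpos _ hk
        have h2 := hpos _ hk'
        simp only [Function.Embedding.subtype_apply]
        rw [e] at h2 ⊢
        generalize x - ((k + 1 : ℕ) : ℤ) = d at h1 h2 ⊢
        simp only [diagNode]
        rcases lt_or_ge d 0 with hd | hd
        · have := diagLen_step_of_neg μ hd
          omega
        · have := diagLen_step_of_nonneg μ hd
          omega
    have hreach' : ∀ p : ((μ.cells \ ν.cells : Finset (ℕ × ℕ)) : Set (ℕ × ℕ)),
        ((SimpleGraph.hasse (ℕ × ℕ)).induce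
          ((μ.cells \ ν.cells : Finset (ℕ × ℕ)) : Set (ℕ × ℕ))).Reachable
          ⟨_, hnode x ⟨by omega, le_rfl⟩⟩ p := by
      rintro ⟨p, hp⟩
      obtain ⟨d, hd, rfl⟩ := hform p hp
      obtain ⟨k, rfl⟩ : ∃ k : ℕ, d = x - k := ⟨(x - d).toNat, by omega⟩
      exact hreach k hd
    exact (SimpleGraph.connected_iff _).2
      ⟨fun p q => (hreach' p).symm.trans (hreach' q), ⟨⟨_, hnode x ⟨by omega, le_rfl⟩⟩⟩⟩
  · rw [Finset.sdiff_sdiff_eq_self hsub]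
    exact ν.isLowerSet
  · rw [Finset.sdiff_sdiff_eq_self hsub]

/-! ### Charges determine cores -/

/-- The `m`-charge of `B` at the residue `j`: the number of non-negative elements of `B` in the class
`j` minus the number of negative integers in the class `j` which are not in `B`. -/
noncomputable def chg (m : ℕ) (B : Set ℤ) (j : ZMod m) : ℤ :=
  ∑ᶠ x : ℤ, if (x : ZMod m) = j then excess B x else 0

theorem support_ite_finite {f : ℤ → ℤ} (hf : (Function.support f).Finite) (p : ℤ → Prop)
    [DecidablePred p] : (Function.support fun x => if p x then f x else 0).Finite := by
  refine hf.subset fun x hx hx' => hx ?_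
  simp only [hx', ite_self]

theorem IsMaya.chg_sub {A B : Set ℤ} (hA : IsMaya A) (hB : IsMaya B) (m : ℕ) (j : ZMod m) :
    chg m A j - chg m B j =
      ∑ᶠ x : ℤ, if (x : ZMod m) = j then excess A x - excess B x else 0 := by
  rw [chg, chg, ← finsum_sub_distrib (support_ite_finite hA.1 _) (support_ite_finite hB.1 _)]
  refine finsum_congr fun x => ?_
  split_ifs <;> simp

theorem finsum_ite_eq_ite (p : ℤ → Prop) [DecidablePred p] (y : ℤ) :
    ∑ᶠ x, (if p x then (if x = y then (1 : ℤ) else 0) else 0) = if p y then 1 else 0 := by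
  rw [finsum_eq_single _ y fun x hx => by simp [hx]]
  simp

theorem IsMaya.moveBead {B : Set ℤ} (hB : IsMaya B) {x y : ℤ} (hx : x ∈ B) (hy : y ∉ B) :
    IsMaya (moveBead B x y) := by
  have he : excess (SimulCores.moveBead B x y) = fun z =>
      (excess B z + (if z = y then 1 else 0)) - if z = x then 1 else 0 :=
    funext fun z => excess_moveBead hx hy z
  have h1 : (Function.support fun z => excess B z + if z = y then (1 : ℤ) else 0).Finite :=
    (hB.1.union (support_ite_eq_finite y)).subset (Function.support_add _ _)
  rw [IsMaya, he]
  refine ⟨(h1.union (support_ite_eq_finite x)).subset (Function.support_sub _ _), ?_⟩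
  rw [finsum_sub_distrib h1 (support_ite_eq_finite x),
    finsum_add_distrib hB.1 (support_ite_eq_finite y), hB.2]
  have := finsum_ite_eq_ite (fun _ => True)
  simp only [if_true] at this
  rw [this, this]
  rfl

theorem IsMaya.chg_moveBead {B : Set ℤ} (hB : IsMaya B) {x y : ℤ} (hx : x ∈ B) (hy : y ∉ B)
    (m : ℕ) (j : ZMod m) : chg m (SimulCores.moveBead B x y) j =
      chg m B j + (if (y : ZMod m) = j then 1 else 0) - if (x : ZMod m) = j then 1 else 0 := by
  have h := (hB.moveBead hx hy).chg_sub hB m j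
  have e : ∀ z : ℤ, (if (z : ZMod m) = j then
      excess (SimulCores.moveBead B x y) z - excess B z else 0) =
      (if (z : ZMod m) = j then (if z = y then (1 : ℤ) else 0) else 0) -
        (if (z : ZMod m) = j then (if z = x then (1 : ℤ) else 0) else 0) := by
    intro z
    rw [excess_moveBead hx hy]
    split_ifs <;> ring
  rw [finsum_congr e, finsum_sub_distrib (support_ite_finite (support_ite_eq_finite y) _)
    (support_ite_finite (support_ite_eq_finite x) _),
    finsum_ite_eq_ite (fun z : ℤ => (z : ZMod m) = j),
    finsum_ite_eq_ite (fun z : ℤ => (z : ZMod m) = j)] at h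
  linarith

theorem RemovesHook.chg_eq {s : ℕ} (hs : 0 < s) {μ ν : YoungDiagram} (h : RemovesHook s μ ν) :
    chg s (beads μ) = chg s (beads ν) := by
  obtain ⟨x, hx, hy, hν⟩ := h.exists_moveBead hs
  funext j
  rw [hν, (isMaya_beads μ).chg_moveBead hx hy]
  simp

theorem Reduces.chg_eq {s k : ℕ} (hs : 0 < s) {μ ν : YoungDiagram} (h : Reduces s k μ ν) :
    chg s (beads μ) = chg s (beads ν) := by
  induction h with
  | refl => rfl
  | step h _ ih => exact (h.chg_eq hs).trans ih

theorem RemovesHook.card_eq {s : ℕ} {μ ν : YoungDiagram} (h : RemovesHook s μ ν) :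
    μ.card = ν.card + s := by
  obtain ⟨H, hH, hν⟩ := h
  have hsub : H ⊆ μ.cells := hH.subset_rim.trans (Finset.filter_subset _ _)
  rw [YoungDiagram.card, YoungDiagram.card, hν, ← hH.card_eq, Finset.card_sdiff_add_card_eq_card hsub]

theorem Reduces.card_eq {s k : ℕ} {μ ν : YoungDiagram} (h : Reduces s k μ ν) :
    μ.card = ν.card + s * k := by
  induction h with
  | refl => rfl
  | step h _ ih => rw [h.card_eq, ih]; ring

theorem isCore_iff {s : ℕ} (hs : 0 < s) {μ : YoungDiagram} :
    IsCore s μ ↔ ∀ x ∈ beads μ, x - s ∈ beads μ := by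
  constructor
  · intro h x hx
    by_contra hy
    obtain ⟨ν, hν⟩ := ((isMaya_beads μ).moveBead hx hy).exists_beads_eq
    obtain ⟨H, hH, -⟩ := removesHook_of_moveBead hs hx hy hν
    exact h H hH
  · intro h H hH
    obtain ⟨x, hx, hy, -⟩ := RemovesHook.exists_moveBead hs
      (⟨H, hH, rfl⟩ : RemovesHook s μ ⟨μ.cells \ H, hH.removable⟩)
    exact hy (h x hx)

theorem sub_mul_mem {s : ℤ} {B : Set ℤ} (h : ∀ x ∈ B, x - s ∈ B) {x : ℤ} (hx : x ∈ B) (k : ℕ) :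
    x - s * k ∈ B := by
  induction k with
  | zero => simpa using hx
  | succ k ih =>
    have := h _ ih
    rwa [sub_sub, ← mul_add_one, ← Nat.cast_succ] at this

/-- In a class modulo s both sets are closed downwards, hence nested. A point of A outside B would
make the class of A strictly larger, and so its charge too. -/
theorem IsMaya.subset_of_chg_eq {s : ℕ} {A B : Set ℤ} (hA : IsMaya A) (hB : IsMaya B)
    (hcA : ∀ x ∈ A, x - s ∈ A) (hcB : ∀ x ∈ B, x - s ∈ B) (h : chg s A = chg s B) : A ⊆ B := by
  intro x hx
  by_contra hxB
  have h0 := hA.chg_sub hB s (x : ZMod s)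
  rw [h, sub_self] at h0
  refine h0.not_lt (finsum_pos (fun z => ?_) ⟨x, ?_⟩ ?_)
  · split_ifs with hz
    · rw [ZMod.intCast_eq_intCast_iff_dvd_sub] at hz
      obtain ⟨c, hc⟩ := hz
      have hzx : z ∈ B → z ∈ A := by
        intro hzB
        rcases le_total 0 c with hc0 | hc0
        · have := sub_mul_mem hcA hx c.toNat
          rwa [Int.toNat_of_nonneg hc0, ← hc, sub_sub_cancel] at this
        · exfalso
          have := sub_mul_mem hcB hzB (-c).toNat
          rw [Int.toNat_of_nonneg (by omega), mul_neg, ← hc, sub_neg_eq_add, add_sub_cancel] at this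
          exact hxB this
      unfold excess
      split_ifs <;> first | omega | exact absurd (hzx ‹_›) ‹_›
    · exact le_rfl
  · unfold excess
    simp [hx, hxB]
  · exact support_ite_finite ((hA.1.union hB.1).subset (Function.support_sub _ _)) _

theorem IsCore.eq_of_chg_eq {s : ℕ} (hs : 0 < s) {μ ν : YoungDiagram} (hμ : IsCore s μ)
    (hν : IsCore s ν) (h : chg s (beads μ) = chg s (beads ν)) : μ = ν := by
  rw [isCore_iff hs] at hμ hν
  exact beads_injective (((isMaya_beads μ).subset_of_chg_eq (isMaya_beads ν) hμ hν h).antisymm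
    ((isMaya_beads ν).subset_of_chg_eq (isMaya_beads μ) hν hμ h.symm))

theorem chg_core {s : ℕ} (hs : 0 < s) (μ : YoungDiagram) :
    chg s (beads (core s μ)) = chg s (beads μ) :=
  ((reduces_core s μ).chg_eq hs).symm

theorem core_eq_iff {s : ℕ} (hs : 0 < s) {μ ν : YoungDiagram} :
    core s μ = core s ν ↔ chg s (beads μ) = chg s (beads ν) := by
  constructor
  · intro h
    rw [← chg_core hs, h, chg_core hs]
  · intro h
    exact (isCore_core s μ).eq_of_chg_eq hs (isCore_core s ν) (by rw [chg_core hs, chg_core hs, h])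

theorem IsCore.core_eq {s : ℕ} (hs : 0 < s) {σ : YoungDiagram} (hσ : IsCore s σ) :
    core s σ = σ :=
  (isCore_core s σ).eq_of_chg_eq hs hσ (chg_core hs σ)

theorem Reduces.core_eq {s k : ℕ} (hs : 0 < s) {μ ν : YoungDiagram} (h : Reduces s k μ ν) :
    core s μ = core s ν :=
  (core_eq_iff hs).2 (h.chg_eq hs)

theorem card_core_add (s : ℕ) (μ : YoungDiagram) :
    μ.card = (core s μ).card + s * weight s μ :=
  (reduces_core s μ).card_eq

/-! ### Reflections -/

open Classical in
/-- The involution of `ℤ` which exchanges `x` and `x - t` for every `x` in the residue class `i`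
modulo `s`. -/
noncomputable def swapClass (s t : ℕ) (i : ZMod s) (x : ℤ) : ℤ :=
  if (x : ZMod s) = i then x - t else if (x : ZMod s) + t = i then x + t else x

theorem swapClass_involutive {s t : ℕ} (h : (t : ZMod s) ≠ 0) (i : ZMod s) :
    Function.Involutive (swapClass s t i) := by
  intro x
  have h' : ∀ a : ZMod s, a + t ≠ a := fun a ha => h (by simpa using ha)
  by_cases h1 : (x : ZMod s) = i
  · have h2 : ((x - t : ℤ) : ZMod s) ≠ i := fun h2 => h' i (by
      push_cast at h2
      rw [← h1, sub_eq_iff_eq_add] at h2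
      rw [← h1]
      exact h2.symm)
    have h3 : ((x - t : ℤ) : ZMod s) + t = i := by push_cast; simpa using h1
    simp only [swapClass, h1, h2, h3, if_true, if_false, sub_add_cancel]
  · by_cases h2 : (x : ZMod s) + t = i
    · have h3 : ((x + t : ℤ) : ZMod s) = i := by push_cast; exact h2
      simp only [swapClass, h1, h2, h3, if_true, if_false, add_sub_cancel_right]
    · simp only [swapClass, h1, h2, if_false]

theorem swapClass_cast_right {s t : ℕ} (i : ZMod s) (x : ℤ) :
    ((swapClass s t i x : ℤ) : ZMod t) = x := by
  unfold swapClass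
  split_ifs <;> simp

theorem swapClass_sub_left {s t : ℕ} (i : ZMod s) (x : ℤ) :
    swapClass s t i (x - s) = swapClass s t i x - s := by
  have h : ((x - s : ℤ) : ZMod s) = x := by simp
  unfold swapClass
  rw [h]
  split_ifs <;> ring

theorem abs_swapClass_sub_le {s t : ℕ} (i : ZMod s) (x : ℤ) :
    x - t ≤ swapClass s t i x ∧ swapClass s t i x ≤ x + t := by
  unfold swapClass
  split_ifs <;> omega

theorem excess_preimage (w : ℤ → ℤ) (B : Set ℤ) (x : ℤ) : excess (w ⁻¹' B) x =
    excess B (w x) + (if w x < 0 then 1 else 0) - if x < 0 then 1 else 0 := by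
  classical
  change (if w x ∈ B then (1 : ℤ) else 0) - _ = (if w x ∈ B then (1 : ℤ) else 0) - _ + _ - _
  ring

/-- Substituting w x for x changes the sign of the summand, so the sum equals its own negative. -/
theorem finsum_excess_preimage_sub {w : ℤ → ℤ} (hw : Function.Involutive w) (B : Set ℤ)
    {p : ℤ → Prop} [DecidablePred p] (hp : ∀ x, p (w x) ↔ p x) :
    ∑ᶠ x, (if p x then excess (w ⁻¹' B) x - excess B x else 0) = 0 := by
  set h : ℤ → ℤ := fun x => if p x then excess (w ⁻¹' B) x - excess B x else 0 with hh
  have h1 : ∑ᶠ x, h (w x) = ∑ᶠ x, h x := finsum_comp_equiv hw.toPerm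
  have h2 : ∀ x, h (w x) = -h x := by
    intro x
    simp only [hh, hp x, excess_preimage, hw x]
    by_cases hx : p x
    · rw [if_pos hx, if_pos hx]
      ring
    · rw [if_neg hx, if_neg hx, neg_zero]
  rw [finsum_congr h2, finsum_neg_distrib] at h1
  exact self_eq_neg.1 h1.symm

theorem IsMaya.preimage_swapClass {s t : ℕ} (h : (t : ZMod s) ≠ 0) (i : ZMod s) {B : Set ℤ}
    (hB : IsMaya B) : IsMaya (swapClass s t i ⁻¹' B) := by
  have hinv := swapClass_involutive h i
  have hfin : (Function.support (excess (swapClass s t i ⁻¹' B))).Finite := by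
    -- Outside [-t, t] the swap cannot change the sign of x, so there the new excess is the old one
    -- at the swapped point.
    refine ((hB.1.preimage hinv.injective.injOn).union (Set.finite_Icc (-t : ℤ) t)).subset ?_
    intro x hx
    by_contra hc
    rw [Set.mem_union, not_or, Set.mem_preimage, Function.notMem_support, Set.mem_Icc] at hc
    refine hx ?_
    have h1 := hc.1
    have h2 := abs_swapClass_sub_le (s := s) (t := t) i x
    rw [excess_preimage, h1]
    split_ifs <;> omega
  refine ⟨hfin, ?_⟩
  have h0 := finsum_excess_preimage_sub hinv B (p := fun _ => True) fun _ => Iff.rfl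
  simp only [if_true] at h0
  rw [finsum_sub_distrib hfin hB.1, hB.2, sub_zero] at h0
  exact h0

theorem exists_reflection {s t : ℕ} (h : (t : ZMod s) ≠ 0) (i : ZMod s) :
    ∃ f : YoungDiagram ≃ YoungDiagram, ∀ μ, beads (f μ) = swapClass s t i ⁻¹' beads μ := by
  choose f hf using fun μ => ((isMaya_beads μ).preimage_swapClass h i).exists_beads_eq
  have hinv : Function.Involutive f := fun μ => beads_injective (by
    rw [hf, hf, ← Set.preimage_comp, (swapClass_involutive h i).comp_self, Set.preimage_id])
  exact ⟨hinv.toPerm, hf⟩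

section reflection

variable {s t : ℕ} {i : ZMod s} {f : YoungDiagram ≃ YoungDiagram}

theorem chg_reflection (h : (t : ZMod s) ≠ 0)
    (hf : ∀ μ, beads (f μ) = swapClass s t i ⁻¹' beads μ) (μ : YoungDiagram) :
    chg t (beads (f μ)) = chg t (beads μ) := by
  funext j
  rw [← sub_eq_zero, (isMaya_beads _).chg_sub (isMaya_beads _), hf]
  exact finsum_excess_preimage_sub (swapClass_involutive h i) _
    fun x => by rw [swapClass_cast_right]

theorem RemovesHook.reflection (hs : 0 < s) (h : (t : ZMod s) ≠ 0)
    (hf : ∀ μ, beads (f μ) = swapClass s t i ⁻¹' beads μ) {μ ν : YoungDiagram}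
    (hμ : RemovesHook s μ ν) : RemovesHook s (f μ) (f ν) := by
  have hinv := swapClass_involutive h i
  obtain ⟨x, hx, hy, hν⟩ := hμ.exists_moveBead hs
  refine removesHook_of_moveBead hs (x := swapClass s t i x) ?_ ?_ ?_
  · rwa [hf, Set.mem_preimage, hinv]
  · rwa [hf, Set.mem_preimage, swapClass_sub_left, hinv]
  · have hiff : ∀ a b : ℤ, swapClass s t i a = b ↔ a = swapClass s t i b := fun a b =>
      ⟨fun hab => by rw [← hab, hinv], fun hab => by rw [hab, hinv]⟩
    ext z
    rw [hf, hf, hν, Set.mem_preimage, mem_moveBead, mem_moveBead, Set.mem_preimage,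
      ← swapClass_sub_left, hiff, ne_eq, ne_eq, hiff]

theorem Reduces.reflection (hs : 0 < s) (h : (t : ZMod s) ≠ 0)
    (hf : ∀ μ, beads (f μ) = swapClass s t i ⁻¹' beads μ) {k : ℕ} {μ ν : YoungDiagram}
    (hμ : Reduces s k μ ν) : Reduces s k (f μ) (f ν) := by
  induction hμ with
  | refl => exact Reduces.refl _
  | step hr _ ih => exact Reduces.step (hr.reflection hs h hf) ih

theorem IsCore.reflection (hs : 0 < s)
    (hf : ∀ μ, beads (f μ) = swapClass s t i ⁻¹' beads μ) {σ : YoungDiagram}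
    (hσ : IsCore s σ) : IsCore s (f σ) := by
  rw [isCore_iff hs] at hσ ⊢
  intro x hx
  rw [hf, Set.mem_preimage] at hx ⊢
  rw [swapClass_sub_left]
  exact hσ _ hx

theorem core_reflection (hs : 0 < s) (h : (t : ZMod s) ≠ 0)
    (hf : ∀ μ, beads (f μ) = swapClass s t i ⁻¹' beads μ) (μ : YoungDiagram) :
    core s (f μ) = f (core s μ) := by
  rw [((reduces_core s μ).reflection hs h hf).core_eq hs]
  exact ((isCore_core s μ).reflection hs hf).core_eq hs

/-- The reflection carries a chain of s-hook removals to one of the same length, so the s-weight is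
unchanged. -/
theorem card_reflection (hs : 0 < s) (h : (t : ZMod s) ≠ 0)
    (hf : ∀ μ, beads (f μ) = swapClass s t i ⁻¹' beads μ) (μ : YoungDiagram) :
    μ.card + (f (core s μ)).card = (f μ).card + (core s μ).card := by
  have h1 := (reduces_core s μ).card_eq
  have h2 := ((reduces_core s μ).reflection hs h hf).card_eq
  omega

end reflection

/-- The moves do not interfere: the target z - t of a point of D is free at the outset, so it is not
itself in D. -/
theorem reduces_of_shift {t : ℕ} (ht : 0 < t) (D : Finset ℤ) : ∀ {μ ν : YoungDiagram},
    (∀ z ∈ D, z ∈ beads μ ∧ z - t ∉ beads μ) →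
    (∀ z, z ∈ beads ν ↔ (z ∈ beads μ ∧ z ∉ D) ∨ z + t ∈ D) → Reduces t D.card μ ν := by
  classical
  induction D using Finset.induction_on with
  | empty =>
    intro μ ν _ hν
    have : μ = ν := beads_injective (Set.ext fun z => by simp [hν z])
    rw [this]
    exact Reduces.refl _
  | insert x D hx ih =>
    intro μ ν hμ hν
    obtain ⟨hx1, hx2⟩ := hμ x (Finset.mem_insert_self _ _)
    obtain ⟨ρ, hρ⟩ := ((isMaya_beads μ).moveBead hx1 hx2).exists_beads_eq
    rw [Finset.card_insert_of_notMem hx]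
    refine Reduces.step (removesHook_of_moveBead ht hx1 hx2 hρ) (ih ?_ ?_)
    · intro z hz
      have h1 := hμ z (Finset.mem_insert_of_mem hz)
      have hzx : z ≠ x := fun h => hx (h ▸ hz)
      rw [hρ, mem_moveBead, mem_moveBead]
      refine ⟨Or.inr ⟨h1.1, hzx⟩, ?_⟩
      rintro (h2 | h2)
      · omega
      · exact h1.2 h2.1
    · intro z
      rw [hν, hρ, mem_moveBead, Finset.mem_insert, Finset.mem_insert]
      have e : z + t = x ↔ z = x - t := by omega
      have h1 : z = x - t → z ∉ D := fun h hz => hx2 (h ▸ (hμ z (Finset.mem_insert_of_mem hz)).1)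
      rw [e]
      tauto

/-- In an s-core the beads of each class modulo s are closed downwards. As x is a bead and x - t is
not, the class of x dominates its translate by t, so the reflection only moves beads down by t. It
is thus a sequence of t-hook removals, nonempty because x moves. -/
theorem card_reflection_lt {s t : ℕ} (hs : 0 < s) (ht : 0 < t) (h : (t : ZMod s) ≠ 0)
    {σ : YoungDiagram} (hσ : IsCore s σ) {x : ℤ} (hx : x ∈ beads σ) (hxt : x - t ∉ beads σ)
    {f : YoungDiagram ≃ YoungDiagram}
    (hf : ∀ μ, beads (f μ) = swapClass s t (x : ZMod s) ⁻¹' beads μ) :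
    (f σ).card < σ.card := by
  classical
  rw [isCore_iff hs] at hσ
  have hfin : {z : ℤ | (z : ZMod s) = x ∧ z ∈ beads σ ∧ z - t ∉ beads σ}.Finite := by
    have h0 := (isMaya_beads σ).1
    refine (h0.union (h0.preimage (sub_left_injective (b := (t : ℤ))).injOn)).subset ?_
    rintro z ⟨-, hz1, hz2⟩
    by_contra hc
    rw [Set.mem_union, not_or, Set.mem_preimage, Function.notMem_support,
      Function.notMem_support] at hc
    unfold excess at hc
    obtain ⟨h1, h2⟩ := hc
    simp only [hz1, hz2, if_true, if_false] at h1 h2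
    split_ifs at h1 h2 <;> omega
  have hD : ∀ z, z ∈ hfin.toFinset ↔ (z : ZMod s) = x ∧ z ∈ beads σ ∧ z - t ∉ beads σ :=
    fun z => hfin.mem_toFinset
  have hmono : ∀ z : ℤ, (z : ZMod s) = x → z - t ∈ beads σ → z ∈ beads σ := by
    intro z hz hzt
    rw [ZMod.intCast_eq_intCast_iff_dvd_sub] at hz
    obtain ⟨c, hc⟩ := hz
    rcases le_total 0 c with hc0 | hc0
    · have := sub_mul_mem hσ hx c.toNat
      rwa [Int.toNat_of_nonneg hc0, ← hc, sub_sub_cancel] at this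
    · exfalso
      have := sub_mul_mem hσ hzt (-c).toNat
      rw [Int.toNat_of_nonneg (by omega), mul_neg, ← hc] at this
      refine hxt ?_
      convert this using 1
      ring
  have h' : ∀ a : ZMod s, a + t ≠ a := fun a ha => h (by simpa using ha)
  have hred : Reduces t hfin.toFinset.card σ (f σ) := by
    refine reduces_of_shift ht _ (fun z hz => ((hD z).1 hz).2) fun z => ?_
    rw [hD, hD, hf, Set.mem_preimage]
    push_cast
    rw [add_sub_cancel_right]
    unfold swapClass
    by_cases h1 : (z : ZMod s) = x
    · have h2 : (z : ZMod s) + t ≠ x := h1 ▸ h' _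
      have h3 := hmono z h1
      rw [if_pos h1]
      refine ⟨fun hz => Or.inl ⟨h3 hz, fun hc => hc.2.2 hz⟩, ?_⟩
      rintro (⟨h4, h5⟩ | ⟨h4, -⟩)
      · by_contra hc
        exact h5 ⟨h1, h4, hc⟩
      · exact absurd h4 h2
    · rw [if_neg h1]
      by_cases h2 : (z : ZMod s) + t = x
      · have h3 := hmono (z + t) (by push_cast; exact h2)
        rw [add_sub_cancel_right] at h3
        rw [if_pos h2]
        refine ⟨fun hz => ?_, ?_⟩
        · by_cases hzB : z ∈ beads σ
          · exact Or.inl ⟨hzB, fun hc => h1 hc.1⟩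
          · exact Or.inr ⟨h2, hz, hzB⟩
        · rintro (⟨h4, -⟩ | ⟨-, h4, -⟩)
          · exact h3 h4
          · exact h4
      · rw [if_neg h2]
        refine ⟨fun hz => Or.inl ⟨hz, fun hc => h1 hc.1⟩, ?_⟩
        rintro (⟨h4, -⟩ | ⟨h4, -⟩)
        · exact h4
        · exact absurd h4 h2
  have hcard : 0 < hfin.toFinset.card := Finset.card_pos.2 ⟨x, (hD x).2 ⟨rfl, hx, hxt⟩⟩
  have := hred.card_eq
  have := Nat.mul_pos ht hcard
  omega

/-- A bijection of partitions which preserves `t`-cores, carries the partitions with `s`-core `σ` to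
those whose `s`-core is the `t`-core of `σ`, and changes the sizes of the former by a constant. -/
theorem exists_equiv_core {s t : ℕ} (hs : 0 < s) (ht : 0 < t) (h : (t : ZMod s) ≠ 0)
    {σ : YoungDiagram} (hσ : IsCore s σ) :
    IsCore s (core t σ) ∧ ∃ f : YoungDiagram ≃ YoungDiagram,
      (∀ μ, core t (f μ) = core t μ) ∧ (∀ μ, core s μ = σ ↔ core s (f μ) = core t σ) ∧
      ∀ μ, core s μ = σ → μ.card + (core t σ).card = (f μ).card + σ.card := by
  induction hn : σ.card using Nat.strong_induction_on generalizing σ with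
  | _ n ih =>
    subst hn
    by_cases hc : IsCore t σ
    · rw [hc.core_eq ht]
      exact ⟨hσ, Equiv.refl _, fun _ => rfl, fun _ => Iff.rfl, fun _ _ => rfl⟩
    · rw [isCore_iff ht] at hc
      push Not at hc
      obtain ⟨x, hx, hxt⟩ := hc
      obtain ⟨r, hr⟩ := exists_reflection h (x : ZMod s)
      have hrt : ∀ μ, core t (r μ) = core t μ := fun μ => (core_eq_iff ht).2 (chg_reflection h hr μ)
      obtain ⟨h1, f, h2, h3, h4⟩ := ih _ (card_reflection_lt hs ht h hσ hx hxt hr)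
        (hσ.reflection hs hr) rfl
      rw [hrt] at h1 h3 h4
      have hcore : ∀ μ, core s μ = σ ↔ core s (r μ) = r σ := fun μ => by
        rw [core_reflection hs h hr, r.injective.eq_iff]
      refine ⟨h1, r.trans f, fun μ => (h2 _).trans (hrt μ), fun μ => (hcore μ).trans (h3 _), ?_⟩
      intro μ hμ
      have h5 := h4 (r μ) ((hcore μ).1 hμ)
      have h6 := card_reflection hs h hr μ
      rw [hμ] at h6
      simp only [Equiv.trans_apply]
      omega

/-! ### Partitions with prescribed s-core and t-core -/

theorem exists_bound_beads (μ : YoungDiagram) :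
    ∃ M : ℕ, ∀ x : ℤ, (x < -M → x ∈ beads μ) ∧ ((M : ℤ) ≤ x → x ∉ beads μ) := by
  obtain ⟨M, hM⟩ := exists_diagLen_eq_zero μ
  have h0 : ∀ x : ℤ, (x + 1 < -M ∨ (M : ℤ) ≤ x) → excess (beads μ) x = 0 := fun x hx => by
    rw [excess_beads, hM x (by omega), hM (x + 1) (by omega), sub_self]
  refine ⟨M + 1, fun x => ⟨fun hx => ?_, fun hx hxB => ?_⟩⟩
  · have := h0 x (by push_cast at hx; omega)
    by_contra hxB
    unfold excess at this
    rw [if_neg hxB] at this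
    split_ifs at this <;> omega
  · have := h0 x (by push_cast at hx; omega)
    unfold excess at this
    rw [if_pos hxB] at this
    split_ifs at this <;> omega

/-- All far negative places carry beads and all far positive ones are free, so a bead of class a
modulo t can be moved to a place of class b modulo t in the same class modulo s. -/
theorem exists_chg_shift {s t : ℕ} (hs : 0 < s) (ht : 0 < t) (hst : Nat.Coprime s t)
    (ρ : YoungDiagram) (a b : ℤ) : ∃ ρ' : YoungDiagram, chg s (beads ρ') = chg s (beads ρ) ∧
      ∀ j, chg t (beads ρ') j = chg t (beads ρ) j + (if (b : ZMod t) = j then 1 else 0) -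
        if (a : ZMod t) = j then 1 else 0 := by
  obtain ⟨M, hM⟩ := exists_bound_beads ρ
  obtain ⟨u, v, huv⟩ := Nat.isCoprime_iff_coprime.2 hst
  have hs1 : (1 : ℤ) ≤ s := by exact_mod_cast hs
  have ht1 : (1 : ℤ) ≤ t := by exact_mod_cast ht
  obtain ⟨x, hx, hxa⟩ : ∃ x ∈ beads ρ, (x : ZMod t) = a := by
    refine ⟨a - t * (|a| + M + 1), (hM _).1 ?_, by simp⟩
    have h1 := le_abs_self a
    have h2 : |a| + M + 1 ≤ t * (|a| + M + 1) := le_mul_of_one_le_left (by positivity) ht1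
    omega
  obtain ⟨y, hy, hyb, hyx⟩ : ∃ y, y ∉ beads ρ ∧ (y : ZMod t) = b ∧ (y : ZMod s) = x := by
    -- Chinese remainder: c is x modulo s and b modulo t. A multiple of s * t then pushes it beyond
    -- all beads.
    set c := x + (b - x) * (u * s) with hc
    refine ⟨c + s * t * (|c| + M), (hM _).2 ?_, ?_, ?_⟩
    · have h1 := neg_abs_le c
      have h2 : |c| + M ≤ s * t * (|c| + M) :=
        le_mul_of_one_le_left (by positivity) (one_le_mul_of_one_le_of_one_le hs1 ht1)
      omega
    · have : c = b - (b - x) * v * t := by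
        rw [hc, eq_sub_of_add_eq huv]
        ring
      rw [this]
      simp
    · rw [hc]
      simp
  obtain ⟨ρ', hρ'⟩ := ((isMaya_beads ρ).moveBead hx hy).exists_beads_eq
  refine ⟨ρ', funext fun j => ?_, fun j => ?_⟩
  · rw [hρ', (isMaya_beads ρ).chg_moveBead hx hy, hyx, add_sub_cancel_right]
  · rw [hρ', (isMaya_beads ρ).chg_moveBead hx hy, hxa, hyb]

/-- The case ν = μ is trivial, and solvability is unaffected by adding or removing a single node in
ν. Any two partitions are linked by such changes through their common 1-core. -/
theorem exists_chg_eq_chg_eq {s t : ℕ} (hs : 0 < s) (ht : 0 < t) (hst : Nat.Coprime s t)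
    (μ ν : YoungDiagram) :
    ∃ ρ, chg s (beads ρ) = chg s (beads μ) ∧ chg t (beads ρ) = chg t (beads ν) := by
  set Q : YoungDiagram → Prop := fun ν =>
    ∃ ρ, chg s (beads ρ) = chg s (beads μ) ∧ chg t (beads ρ) = chg t (beads ν)
  have hstep : ∀ {α β : YoungDiagram}, RemovesHook 1 α β → (Q α ↔ Q β) := by
    intro α β h
    obtain ⟨x, hx, hy, hβ⟩ := h.exists_moveBead one_pos
    have hchg := fun j => (isMaya_beads α).chg_moveBead hx hy t j
    rw [← hβ] at hchg
    constructor
    · rintro ⟨ρ, h1, h2⟩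
      obtain ⟨ρ', h3, h4⟩ := exists_chg_shift hs ht hst ρ x (x - (1 : ℕ))
      exact ⟨ρ', h3.trans h1, funext fun j => by rw [h4, hchg, h2]⟩
    · rintro ⟨ρ, h1, h2⟩
      obtain ⟨ρ', h3, h4⟩ := exists_chg_shift hs ht hst ρ (x - (1 : ℕ)) x
      exact ⟨ρ', h3.trans h1, funext fun j => by rw [h4, h2, hchg]; ring⟩
  have hred : ∀ {k : ℕ} {α β : YoungDiagram}, Reduces 1 k α β → (Q α ↔ Q β) := by
    intro k α β h
    induction h with
    | refl => exact Iff.rfl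
    | step h _ ih => exact (hstep h).trans ih
  have hcore : core 1 μ = core 1 ν := by
    have h0 : ∀ (α : YoungDiagram) (j : ZMod 1), chg 1 (beads α) j = 0 := fun α j => by
      rw [chg, ← (isMaya_beads α).2]
      exact finsum_congr fun x => if_pos (Subsingleton.elim _ _)
    exact (core_eq_iff one_pos).2 (funext fun j => by rw [h0, h0])
  exact (hred (reduces_core 1 ν)).2 (hcore ▸ (hred (reduces_core 1 μ)).1 ⟨μ, rfl, rfl⟩)

/-! ### Non-uniqueness away from cores -/

theorem moveBead_moveBead {B : Set ℤ} {x y : ℤ} (hx : x ∈ B) (hy : y ∉ B) :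
    moveBead (moveBead B x y) y x = B := by
  ext z
  rw [mem_moveBead, mem_moveBead]
  have h1 : z = x → z ∈ B := fun h => h ▸ hx
  have h2 : z = y → z ∉ B := fun h => h ▸ hy
  tauto

/-- Compare μ with its t-core over the class of x modulo t. Equal t-charges make the sum of the
differences of excess at z, minus those at z - s, vanish. Without a suitable y every term would be
non-negative, as the t-core is an s-core, and the term at x would be positive. -/
theorem exists_bead_pair {s t : ℕ} (hs : 0 < s) (ht : 0 < t) {μ : YoungDiagram}
    (hc : IsCore s (core t μ)) {x : ℤ} (hx : x ∈ beads μ) (hxs : x - s ∉ beads μ) :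
    ∃ y : ℤ, (y : ZMod t) = x ∧ y ∉ beads μ ∧ y - s ∈ beads μ := by
  by_contra! hy
  have hA := isMaya_beads μ
  have hB := isMaya_beads (core t μ)
  rw [isCore_iff hs] at hc
  have hchg := chg_core ht μ
  generalize beads μ = A at *
  generalize beads (core t μ) = B at *
  have hf := (hA.1.union hB.1).subset (Function.support_sub _ _)
  set F : ℤ → ℤ := fun z => if (z : ZMod t) = x then excess A z - excess B z else 0 with hF
  set G : ℤ → ℤ := fun z =>
    if (z : ZMod t) = ((x - s : ℤ) : ZMod t) then excess A z - excess B z else 0 with hG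
  have hFfin : (Function.support F).Finite := support_ite_finite hf _
  have hGfin' : (Function.support G).Finite := support_ite_finite hf _
  have hGfin : (Function.support fun z => G (z - s)).Finite :=
    hGfin'.preimage (sub_left_injective (b := (s : ℤ))).injOn
  have hF0 : ∑ᶠ z, F z = 0 := by rw [← hA.chg_sub hB, hchg, sub_self]
  have hG0 : ∑ᶠ z, G (z - s) = 0 := by
    have hshift : ∑ᶠ z, G (z - s) = ∑ᶠ z, G z := finsum_comp_equiv (Equiv.subRight (s : ℤ))
    rw [hshift, ← hA.chg_sub hB, hchg, sub_self]
  have hsum := finsum_sub_distrib hFfin hGfin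
  rw [hF0, hG0, sub_zero] at hsum
  have hGz : ∀ z, G (z - s) =
      if (z : ZMod t) = x then excess A (z - s) - excess B (z - s) else 0 := fun z => by
    simp only [hG, Int.cast_sub, sub_left_inj]
  refine hsum.symm.not_lt (finsum_pos (fun z => ?_) ⟨x, ?_⟩
    ((hFfin.union hGfin).subset (Function.support_sub _ _)))
  · rw [hGz]
    simp only [hF]
    split_ifs with hz
    · have h1 := hy z hz
      have h2 := hc z
      unfold excess
      split_ifs <;> first | omega | (exfalso; tauto)
    · simp
  · rw [hGz]
    simp only [hF, if_true]
    have h2 := hc x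
    unfold excess
    rw [if_pos hx, if_neg hxs]
    split_ifs <;> first | omega | (exfalso; tauto)

/-- Move x down to x - s and y - s up to y, with y from `exists_bead_pair`. The two moves cancel in
size and in s-charge, and also in t-charge because y and x agree modulo t. -/
theorem exists_ne_of_not_isCore {s t : ℕ} (hs : 0 < s) (ht : 0 < t) (h : (s : ZMod t) ≠ 0)
    {μ : YoungDiagram} (hc : IsCore s (core t μ)) (hμ : ¬ IsCore s μ) :
    ∃ ν, ν ≠ μ ∧ ν.card = μ.card ∧ core s ν = core s μ ∧ core t ν = core t μ := by
  rw [isCore_iff hs] at hμ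
  push Not at hμ
  obtain ⟨x, hx, hxs⟩ := hμ
  obtain ⟨y, hyx, hy, hys⟩ := exists_bead_pair hs ht hc hx hxs
  -- As s is nonzero modulo t, the second move neither uses the bead x nor undoes the first move.
  have hne : y - s ≠ x := fun hc => h (by
    rw [← hc] at hyx
    push_cast at hyx
    exact sub_eq_self.1 hyx.symm)
  have hne' : y ≠ x - s := fun hc => h (by
    rw [hc] at hyx
    push_cast at hyx
    exact sub_eq_self.1 hyx)
  have hM := (isMaya_beads μ).moveBead hx hxs
  obtain ⟨ρ, hρ⟩ := hM.exists_beads_eq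
  have hy1 : y - s ∈ beads ρ := by
    rw [hρ, mem_moveBead]
    exact Or.inr ⟨hys, hne⟩
  have hy2 : y ∉ beads ρ := by
    rw [hρ, mem_moveBead]
    rintro (h1 | h1)
    · exact hne' h1
    · exact hy h1.1
  obtain ⟨ν, hν⟩ := ((isMaya_beads ρ).moveBead hy1 hy2).exists_beads_eq
  have hr1 : RemovesHook s μ ρ := removesHook_of_moveBead hs hx hxs hρ
  have hr2 : RemovesHook s ν ρ := by
    refine removesHook_of_moveBead hs (x := y) ?_ ?_ ?_
    · rw [hν, mem_moveBead]
      exact Or.inl rfl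
    · rw [hν, mem_moveBead]
      rintro (h1 | h1)
      · omega
      · exact h1.2 rfl
    · rw [hν, moveBead_moveBead hy1 hy2]
  refine ⟨ν, fun hc => ?_, ?_, ?_, ?_⟩
  · have : x ∈ beads ν := hc ▸ hx
    rw [hν, mem_moveBead, hρ, mem_moveBead] at this
    rcases this with h1 | ⟨h1 | h1, -⟩
    · exact hy (h1 ▸ hx)
    · omega
    · exact h1.2 rfl
  · rw [hr1.card_eq, hr2.card_eq]
  · rw [core_eq_iff hs, hr1.chg_eq hs, hr2.chg_eq hs]
  · rw [core_eq_iff ht]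
    funext j
    rw [hν, (isMaya_beads ρ).chg_moveBead hy1 hy2, hρ, (isMaya_beads μ).chg_moveBead hx hxs]
    push_cast
    rw [hyx]
    ring

/-! ### Minimal partitions and the equivalence -/

theorem eq_core_of_card_le {s : ℕ} (hs : 0 < s) {μ : YoungDiagram}
    (h : μ.card ≤ (core s μ).card) : μ = core s μ := by
  have h1 := card_core_add s μ
  have h2 : weight s μ = 0 := by
    by_contra hw
    have := Nat.mul_pos hs (Nat.pos_of_ne_zero hw)
    omega
  have h3 := reduces_core s μ
  rw [h2] at h3
  generalize core s μ = ν at h3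
  cases h3
  rfl

theorem minimalPartitions_nonempty {s t : ℕ} (hs : 0 < s) (ht : 0 < t) (hst : Nat.Coprime s t)
    {σ τ : YoungDiagram} (hσ : IsCore s σ) (hτ : IsCore t τ) :
    (minimalPartitions s t σ τ).Nonempty := by
  obtain ⟨ρ, h1, h2⟩ := exists_chg_eq_chg_eq hs ht hst σ τ
  have hne : {μ : YoungDiagram | core s μ = σ ∧ core t μ = τ}.Nonempty :=
    ⟨ρ, ((core_eq_iff hs).2 h1).trans (hσ.core_eq hs), ((core_eq_iff ht).2 h2).trans (hτ.core_eq ht)⟩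
  obtain ⟨μ, ⟨hμ1, hμ2⟩, hmin⟩ :=
    (InvImage.wf YoungDiagram.card wellFounded_lt).has_min _ hne
  refine ⟨μ, hμ1, hμ2, fun ν h3 h4 => ?_⟩
  exact not_lt.1 (hmin ν ⟨h3.trans hμ1, h4.trans hμ2⟩)

end SimulCores

theorem theorem5p9 (s t : ℕ) (hs : 1 < s) (ht : 1 < t) (hst : Nat.Coprime s t)
    (σ τ : YoungDiagram) (hσ : SimulCores.IsCore s σ) (hτ : SimulCores.IsCore t τ) (n : ℕ) :
    (SimulCores.minimalPartitions s t σ τ).Nonempty ∧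
    List.TFAE [
      (SimulCores.partitionsWithCores s t σ τ n).ncard = 1,
      SimulCores.core t σ = SimulCores.core s τ ∧
        (n : ℤ) = (σ.card : ℤ) + (τ.card : ℤ) - ((SimulCores.core t σ).card : ℤ),
      n = SimulCores.minSize s t σ τ ∧
        SimulCores.minSize s t σ τ = τ.card + t * SimulCores.weight t σ,
      n = SimulCores.minSize s t σ τ ∧
        SimulCores.minSize s t σ τ = σ.card + s * SimulCores.weight s τ] := by
  open SimulCores in
  have hs0 : 0 < s := by omega
  have ht0 : 0 < t := by omega
  -- Each reflection must exchange two distinct residue classes.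
  have hts : (t : ZMod s) ≠ 0 := fun h =>
    hs.ne' (Nat.eq_one_of_dvd_coprimes hst dvd_rfl ((ZMod.natCast_eq_zero_iff _ _).1 h))
  have hst' : (s : ZMod t) ≠ 0 := fun h =>
    ht.ne' (Nat.eq_one_of_dvd_coprimes hst ((ZMod.natCast_eq_zero_iff _ _).1 h) dvd_rfl)
  have hne := minimalPartitions_nonempty hs0 ht0 hst hσ hτ
  obtain ⟨hκs, f, f1, f2, f3⟩ := exists_equiv_core hs0 ht0 hts hσ
  obtain ⟨hκt, g, g1, g2, g3⟩ := exists_equiv_core ht0 hs0 hst' hτ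
  have hwσ := card_core_add t σ
  have hwτ := card_core_add s τ
  have hκs' : IsCore s (core s τ) := isCore_core s τ
  have hκt' : IsCore t (core t σ) := isCore_core t σ
  set κ := core t σ
  set κ' := core s τ
  -- `f` replaces the s-core σ by κ and `g` the t-core τ by κ', each leaving the other core alone.
  set e : YoungDiagram ≃ YoungDiagram := f.trans g with he
  have hcores : ∀ μ, (core s μ = σ ∧ core t μ = τ) ↔ (core s (e μ) = κ ∧ core t (e μ) = κ') := by
    intro μ
    rw [he, Equiv.trans_apply, g1, ← f2, ← g2, f1]
  have hcard : ∀ μ, core s μ = σ → core t μ = τ →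
      μ.card + κ.card + κ'.card = (e μ).card + σ.card + τ.card := by
    intro μ h1 h2
    have h3 := f3 μ h1
    have h4 := g3 (f μ) ((f1 μ).trans h2)
    rw [he, Equiv.trans_apply]
    omega
  have hsucc : κ = κ' → core s (e.symm κ) = σ ∧ core t (e.symm κ) = τ := fun h => by
    rw [hcores, Equiv.apply_symm_apply, hκs.core_eq hs0, hκt'.core_eq ht0]
    exact ⟨rfl, h⟩
  have hmin : κ = κ' → minSize s t σ τ + κ.card = σ.card + τ.card := by
    intro h
    obtain ⟨h1, h2⟩ := hsucc h
    have h3 := hcard _ h1 h2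
    rw [Equiv.apply_symm_apply, ← h] at h3
    rw [← card_eq_minSize (μ := e.symm κ) ⟨h1, h2, fun ν h4 h5 => ?_⟩]
    · omega
    · have h6 := hcard ν (h4.trans h1) (h5.trans h2)
      have h7 := card_core_add s (e ν)
      have h8 : κ.card = κ'.card := by rw [← h]
      rw [((hcores ν).1 ⟨h4.trans h1, h5.trans h2⟩).1] at h7
      omega
  refine ⟨hne, ?_⟩
  obtain ⟨ρ, hρ⟩ := hne
  have hρmin := card_eq_minSize hρ
  have hρcard := hcard ρ hρ.1 hρ.2.1
  obtain ⟨hρ1, hρ2⟩ := (hcores ρ).1 ⟨hρ.1, hρ.2.1⟩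
  tfae_have 1 → 2 := by
    intro h
    obtain ⟨μ, hμ⟩ := Set.ncard_eq_one.1 h
    obtain ⟨h0, h1, h2⟩ : μ ∈ partitionsWithCores s t σ τ n := hμ ▸ Set.mem_singleton μ
    obtain ⟨h3, h4⟩ := (hcores μ).1 ⟨h1, h2⟩
    have h5 := hcard μ h1 h2
    -- On partitions with cores σ and τ, `e` shifts sizes by a constant, so uniqueness passes to `e
    -- μ` among partitions of its size with cores κ and κ'.
    have huniq : ¬ ∃ ν, ν ≠ e μ ∧ ν.card = (e μ).card ∧ core s ν = core s (e μ) ∧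
        core t ν = core t (e μ) := by
      rintro ⟨ν, hne, h6, h7, h8⟩
      have h9 : core s (e.symm ν) = σ ∧ core t (e.symm ν) = τ := by
        rw [hcores, Equiv.apply_symm_apply]
        exact ⟨h7.trans h3, h8.trans h4⟩
      have h10 := hcard _ h9.1 h9.2
      rw [Equiv.apply_symm_apply] at h10
      have h11 : e.symm ν ∈ partitionsWithCores s t σ τ n := ⟨by omega, h9⟩
      rw [hμ, Set.mem_singleton_iff, Equiv.symm_apply_eq] at h11
      exact hne h11
    have h6 : IsCore s (e μ) := by
      by_contra hc
      exact huniq (exists_ne_of_not_isCore hs0 ht0 hst' (h4 ▸ hκs') hc)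
    have h7 : IsCore t (e μ) := by
      by_contra hc
      obtain ⟨ν, k1, k2, k3, k4⟩ := exists_ne_of_not_isCore ht0 hs0 hts (h3 ▸ hκt') hc
      exact huniq ⟨ν, k1, k2, k4, k3⟩
    rw [h6.core_eq hs0] at h3
    rw [h7.core_eq ht0] at h4
    have h8 : κ = κ' := h3.symm.trans h4
    rw [h3, ← h8] at h5
    exact ⟨h8, by omega⟩
  tfae_have 2 → 1 := by
    rintro ⟨h, hn⟩
    refine Set.ncard_eq_one.2 ⟨e.symm κ, Set.eq_singleton_iff_unique_mem.2 ⟨?_, ?_⟩⟩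
    · obtain ⟨h1, h2⟩ := hsucc h
      have h3 := hcard _ h1 h2
      rw [Equiv.apply_symm_apply, ← h] at h3
      exact ⟨by omega, h1, h2⟩
    · rintro μ ⟨h0, h1, h2⟩
      have h3 := hcard μ h1 h2
      have h4 := ((hcores μ).1 ⟨h1, h2⟩).1
      rw [← h] at h3
      rw [Equiv.eq_symm_apply, ← h4]
      exact eq_core_of_card_le hs0 (by rw [h4]; omega)
  tfae_have 2 → 3 := by
    rintro ⟨h, hn⟩
    have := hmin h
    omega
  tfae_have 2 → 4 := by
    rintro ⟨h, hn⟩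
    have := hmin h
    rw [← h] at hwτ
    omega
  tfae_have 3 → 2 := by
    rintro ⟨hn, hm⟩
    -- The assumed size of ρ makes |e ρ| = |κ'|, the size of its t-core.
    have h1 : e ρ = κ' := hρ2 ▸ eq_core_of_card_le ht0 (by rw [hρ2]; omega)
    have h2 : κ = κ' := by rw [← hρ1, h1, hκs'.core_eq hs0]
    exact ⟨h2, by omega⟩
  tfae_have 4 → 2 := by
    rintro ⟨hn, hm⟩
    have h1 : e ρ = κ := hρ1 ▸ eq_core_of_card_le hs0 (by rw [hρ1]; omega)
    have h2 : κ = κ' := by rw [← hρ2, h1, hκt'.core_eq ht0]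
    exact ⟨h2, by rw [← h2] at hwτ; omega⟩
  tfae_finish
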